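/- Let $n\ge 1$ be an integer, $I^n=[0,1]^n$ and $[n]=\{1,\dots,n\}$. For $k\ge 1$ let $\mathcal K_k^n$ be the family of the $k^n$ cubes $\prod_{s=1}^n\left[\frac{i_s-1}{k},\frac{i_s}{k}\right]$ with $i_s\in\{1,\dots,k\}$. A set $S\subset I^n$ connects the $i$th opposite faces of $I^n$ if $S$ is connected and contains a point $z$ with $z_i=0$ and a point $z'$ with $z'_i=1$; it connects some opposite faces if this holds for some $i\in[n]$. Consider the following two statements in dimension $n$. (B$_n$) For every continuous $f\colon I^n\to\mathbb R^{n-1}$ there are a point $p\in\mathbb R^{n-1}$ and a compact set $S\subset f^{-1}(\{p\})$ that connects some opposite faces of $I^n$. (C$_n$) ($n$-dimensional Steinhaus Chessboard Theorem.) For every $k\ge 1$ and every $F\colon\mathcal K_k^n\to[n]$ there are $c\in[n]$ and $\mathcal S\subset F^{-1}(\{c\})$ such that $\bigcup\mathcal S$ connects some opposite faces of $I^n$. Theorem. For every $n\ge 1$, (B$_n$) implies (C$_n$). More precisely, let $k\ge 1$ and $F\colon\mathcal K_k^n\to[n]$. Then there is a continuous map $f=(f_1,\dots,f_{n-1})\colon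 I^n\to\mathbb R^{n-1}$ such that $f_j^{-1}(\{0\})=\bigcup F^{-1}(\{j\})$ for every $1\le j\le n-1$. Moreover, for every such $f$, every $p\in\mathbb R^{n-1}$, every $i\in[n]$ and every set $S\subset f^{-1}(\{p\})$ that connects the $i$th opposite faces of $I^n$, there are $c\in[n]$ and $\mathcal S\subset F^{-1}(\{c\})$ such that $S\subset\bigcup\mathcal S$ and $\bigcup\mathcal S$ connects the $i$th opposite faces of $I^n$. -/

import Mathlib

namespace LevelSetChess

/-- `ℝⁿ` with its Euclidean norm. -/
abbrev Space (n : ℕ) : Type := EuclideanSpace ℝ (Fin n)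

/-- The unit cube `Iⁿ = [0,1]ⁿ`. -/
def unitCube (n : ℕ) : Set (Space n) := {x | ∀ s, x s ∈ Set.Icc (0 : ℝ) 1}

/-- The face `{z ∈ Iⁿ : z_i = 0}`. -/
def lowerFace {n : ℕ} (i : Fin n) : Set (Space n) := {z | z ∈ unitCube n ∧ z i = 0}

/-- The face `{z ∈ Iⁿ : z_i = 1}`. -/
def upperFace {n : ℕ} (i : Fin n) : Set (Space n) := {z | z ∈ unitCube n ∧ z i = 1}

/-- `S ⊆ Iⁿ` connects the `i`th opposite faces of `Iⁿ`. -/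
def ConnectsFaces {n : ℕ} (i : Fin n) (S : Set (Space n)) : Prop :=
  S ⊆ unitCube n ∧ IsConnected S ∧ (S ∩ lowerFace i).Nonempty ∧ (S ∩ upperFace i).Nonempty

/-- `S ⊆ Iⁿ` connects some opposite faces of `Iⁿ`. -/
def ConnectsSomeFaces {n : ℕ} (S : Set (Space n)) : Prop := ∃ i : Fin n, ConnectsFaces i S

/-- The small cube `∏ₛ [iₛ/k, (iₛ+1)/k]`, where each `iₛ` runs through `0, …, k-1`. -/
def smallCube (n k : ℕ) (i : Fin n → Fin k) : Set (Space n) :=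
  {x | ∀ s, x s ∈ Set.Icc (((i s : ℕ) : ℝ) / (k : ℝ)) ((((i s : ℕ) : ℝ) + 1) / (k : ℝ))}

/-- The division of `Iⁿ` into `kⁿ` small cubes. -/
def cubes (n k : ℕ) : Set (Set (Space n)) := Set.range (smallCube n k)

/-- The union of a family of small cubes. -/
def cubesUnion {n k : ℕ} (T : Set (cubes n k)) : Set (Space n) := ⋃ K ∈ T, (K : Set (Space n))

/-- The level set theorem in dimension `n`: every continuous map `Iⁿ → ℝⁿ⁻¹` has a fibre that
contains a compact set connecting some opposite faces of `Iⁿ`. -/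
def LevelSetTheorem (n : ℕ) : Prop :=
  ∀ f : Space n → Space (n - 1), ContinuousOn f (unitCube n) →
    ∃ (p : Space (n - 1)) (S : Set (Space n)),
      IsCompact S ∧ S ⊆ unitCube n ∩ f ⁻¹' {p} ∧ ConnectsSomeFaces S

/-- The Steinhaus Chessboard Theorem in dimension `n`. The colors `1, …, n` are `Fin n`. -/
def SteinhausChessboardTheorem (n : ℕ) : Prop :=
  ∀ k : ℕ, 1 ≤ k → ∀ F : cubes n k → Fin n,
    ∃ (c : Fin n) (T : Set (cubes n k)), T ⊆ F ⁻¹' {c} ∧ ConnectsSomeFaces (cubesUnion T)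

/-- `f = (f_1, …, f_{n-1}) : Iⁿ → ℝⁿ⁻¹` is continuous, and for each of the first `n - 1` colors `j`
the zero set of `f_j` in `Iⁿ` is the union of the cubes of color `j`. -/
def EncodesColoring {n k : ℕ} (F : cubes n k → Fin n) (f : Space n → Space (n - 1)) : Prop :=
  ContinuousOn f (unitCube n) ∧
    ∀ j : Fin (n - 1),
      {x | x ∈ unitCube n ∧ f x j = 0} = cubesUnion (F ⁻¹' {Fin.castLE (Nat.sub_le n 1) j})

end LevelSetChess

/-! Suppose that the zero set of each coordinate of `f` is the union of the cubes of one color, for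
all colors but the last; a continuous such `f` exists because these unions are closed. If `p` has a
zero coordinate `j`, then the fibre over `p` lies in the cubes of color `j`. Otherwise it avoids the
cubes of every color but the last, so it lies in the cubes of the last color. Either way a set `S`
inside a fibre is covered by cubes of a single color, and those of them that meet `S` have a
connected union as soon as `S` is connected. -/

namespace LevelSetChess

section Connectedness

variable {X ι : Type*} {S : Set X} {I : Set ι} {u : ι → Set X}

theorem subset_biUnion_inter_nonempty (hS : S ⊆ ⋃ i ∈ I, u i) :
    S ⊆ ⋃ i ∈ {i ∈ I | (S ∩ u i).Nonempty}, u i := by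
  intro x hx
  obtain ⟨i, hi, hxi⟩ := Set.mem_iUnion₂.1 (hS hx)
  exact Set.mem_biUnion ⟨hi, x, hx, hxi⟩ hxi

theorem isConnected_biUnion_of_inter_nonempty [TopologicalSpace X] (hS : IsConnected S)
    (hSu : S ⊆ ⋃ i ∈ I, u i) (hu : ∀ i ∈ I, IsPreconnected (u i))
    (hmeet : ∀ i ∈ I, (S ∩ u i).Nonempty) : IsConnected (⋃ i ∈ I, u i) := by
  obtain ⟨x, hx⟩ := hS.nonempty
  refine ⟨⟨x, hSu hx⟩, isPreconnected_of_forall x fun y hy => ?_⟩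
  obtain ⟨i, hi, hyi⟩ := Set.mem_iUnion₂.1 hy
  exact ⟨S ∪ u i, Set.union_subset hSu (Set.subset_biUnion_of_mem hi), Or.inl hx, Or.inr hyi,
    hS.isPreconnected.union' (hmeet i hi) (hu i hi)⟩

end Connectedness

theorem exists_mem_Icc_div {K : Type*} [Field K] [LinearOrder K] [IsStrictOrderedRing K]
    [FloorSemiring K] {k : ℕ} (hk : 0 < k) {t : K} (ht : t ∈ Set.Icc (0 : K) 1) :
    ∃ m : Fin k, t ∈ Set.Icc (((m : ℕ) : K) / k) ((((m : ℕ) : K) + 1) / k) := by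
  have hk' : (0 : K) < k := Nat.cast_pos.2 hk
  obtain hlt | rfl := ht.2.lt_or_eq
  · have h0 : 0 ≤ t * k := mul_nonneg ht.1 hk'.le
    have hfloor : ⌊t * k⌋₊ < k := (Nat.floor_lt h0).2 (mul_lt_of_lt_one_left hk' hlt)
    exact ⟨⟨⌊t * k⌋₊, hfloor⟩, (div_le_iff₀ hk').2 (Nat.floor_le h0),
      (le_div_iff₀ hk').2 (Nat.lt_floor_add_one _).le⟩
  · have hlast : ((k - 1 : ℕ) : K) + 1 = k := by exact_mod_cast Nat.sub_add_cancel hk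
    refine ⟨⟨k - 1, Nat.sub_one_lt hk.ne'⟩, (div_le_one hk').2 ?_, (one_le_div hk').2 hlast.ge⟩
    exact (le_add_of_nonneg_right zero_le_one).trans hlast.le

section Cubes

variable {n k : ℕ}

theorem isClosed_of_mem_cubes {K : Set (Space n)} (hK : K ∈ cubes n k) : IsClosed K := by
  obtain ⟨i, rfl⟩ := hK
  simp only [smallCube, Set.ofPred_forall]
  exact isClosed_iInter fun s => isClosed_Icc.preimage (by fun_prop)

theorem convex_of_mem_cubes {K : Set (Space n)} (hK : K ∈ cubes n k) : Convex ℝ K := by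
  obtain ⟨i, rfl⟩ := hK
  exact fun x hx y hy a b ha hb hab s => convex_Icc _ _ (hx s) (hy s) ha hb hab

theorem subset_unitCube_of_mem_cubes {K : Set (Space n)} (hK : K ∈ cubes n k) :
    K ⊆ unitCube n := by
  obtain ⟨i, rfl⟩ := hK
  intro x hx s
  have hk : (0 : ℝ) < k := Nat.cast_pos.2 (i s).pos
  have hi : ((i s : ℕ) : ℝ) + 1 ≤ k := by exact_mod_cast (i s).isLt
  exact ⟨le_trans (by positivity) (hx s).1, (hx s).2.trans ((div_le_one hk).2 hi)⟩

theorem exists_mem_cubes_of_mem_unitCube (hk : 0 < k) {x : Space n} (hx : x ∈ unitCube n) :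
    ∃ K : cubes n k, x ∈ (K : Set (Space n)) := by
  choose i hi using fun s => exists_mem_Icc_div hk (hx s)
  exact ⟨⟨_, i, rfl⟩, hi⟩

theorem mem_cubesUnion {T : Set (cubes n k)} {x : Space n} :
    x ∈ cubesUnion T ↔ ∃ K ∈ T, x ∈ (K : Set (Space n)) := by
  simp only [cubesUnion, Set.mem_iUnion, exists_prop]

theorem isClosed_cubesUnion (T : Set (cubes n k)) : IsClosed (cubesUnion T) :=
  have : Finite (cubes n k) := Set.finite_range (smallCube n k)
  T.toFinite.isClosed_biUnion fun K _ => isClosed_of_mem_cubes K.2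

theorem cubesUnion_subset_unitCube (T : Set (cubes n k)) : cubesUnion T ⊆ unitCube n :=
  Set.iUnion₂_subset fun K _ => subset_unitCube_of_mem_cubes K.2

theorem ConnectsFaces.mono {i : Fin n} {S S' : Set (Space n)} (hS : ConnectsFaces i S)
    (hSS' : S ⊆ S') (hsub : S' ⊆ unitCube n) (hconn : IsConnected S') : ConnectsFaces i S' :=
  ⟨hsub, hconn, hS.2.2.imp (·.mono (Set.inter_subset_inter_left _ hSS'))
    (·.mono (Set.inter_subset_inter_left _ hSS'))⟩

theorem ConnectsFaces.exists_subset_cubesUnion {i : Fin n} {S : Set (Space n)}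
    {C : Set (cubes n k)} (hS : ConnectsFaces i S) (hSC : S ⊆ cubesUnion C) :
    ∃ T ⊆ C, S ⊆ cubesUnion T ∧ ConnectsFaces i (cubesUnion T) := by
  let T : Set (cubes n k) := {K ∈ C | (S ∩ K).Nonempty}
  have hST : S ⊆ cubesUnion T := subset_biUnion_inter_nonempty hSC
  have hT : IsConnected (cubesUnion T) := isConnected_biUnion_of_inter_nonempty hS.2.1 hST
    (fun K _ => (convex_of_mem_cubes K.2).isPreconnected) fun _ hK => hK.2
  exact ⟨T, Set.sep_subset _ _, hST, hS.mono hST (cubesUnion_subset_unitCube T) hT⟩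

end Cubes

section Colorings

variable {n k d : ℕ} {F : cubes n k → Fin (d + 1)} {f : Space n → Space d} {p : Space d}

/-- The zero sets in `Iⁿ` of the coordinates of `f` are the unions of the cubes of each color but
the last. This is the second half of `EncodesColoring`, for any number `d + 1` of colors. -/
def ZeroSetsEncode (F : cubes n k → Fin (d + 1)) (f : Space n → Space d) : Prop :=
  ∀ j : Fin d, {x | x ∈ unitCube n ∧ f x j = 0} = cubesUnion (F ⁻¹' {j.castSucc})

/-- The conclusion of the level set theorem for maps to `ℝᵈ`, where the set inside the fibre need
not be compact and only maps that are continuous on all of `ℝⁿ` are considered. -/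
def HasConnectingFibres (n d : ℕ) : Prop :=
  ∀ f : Space n → Space d, Continuous f →
    ∃ (p : Space d) (S : Set (Space n)), S ⊆ unitCube n ∩ f ⁻¹' {p} ∧ ConnectsSomeFaces S

theorem LevelSetTheorem.hasConnectingFibres (h : LevelSetTheorem n) :
    HasConnectingFibres n (n - 1) := fun f hf =>
  let ⟨p, S, _, hS⟩ := h f hf.continuousOn
  ⟨p, S, hS⟩

theorem exists_continuous_zeroSetsEncode (F : cubes n k → Fin (d + 1)) :
    ∃ f : Space n → Space d, Continuous f ∧ ZeroSetsEncode F f := by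
  choose g hg _ using fun j : Fin d =>
    perfectlyNormalSpace_iff_forall_isClosed_preimage_zero.1 inferInstance _
      (isClosed_cubesUnion (F ⁻¹' {j.castSucc}))
  refine ⟨fun x => WithLp.toLp 2 fun j => g j x, by fun_prop, fun j => ?_⟩
  calc {x | x ∈ unitCube n ∧ g j x = 0} = unitCube n ∩ g j ⁻¹' {0} := rfl
    _ = unitCube n ∩ cubesUnion (F ⁻¹' {j.castSucc}) := by rw [← hg j]
    _ = cubesUnion (F ⁻¹' {j.castSucc}) :=
      Set.inter_eq_right.2 (cubesUnion_subset_unitCube _)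

theorem ZeroSetsEncode.fibre_subset_of_apply_eq_zero (hf : ZeroSetsEncode F f) {j : Fin d}
    (hj : p j = 0) : unitCube n ∩ f ⁻¹' {p} ⊆ cubesUnion (F ⁻¹' {j.castSucc}) := by
  rintro x ⟨hx, rfl⟩
  exact (hf j).subset ⟨hx, hj⟩

theorem ZeroSetsEncode.fibre_subset_of_forall_ne_zero (hf : ZeroSetsEncode F f) (hk : 0 < k)
    (hp : ∀ j, p j ≠ 0) : unitCube n ∩ f ⁻¹' {p} ⊆ cubesUnion (F ⁻¹' {Fin.last d}) := by
  rintro x ⟨hx, rfl⟩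
  obtain ⟨K, hxK⟩ := exists_mem_cubes_of_mem_unitCube hk hx
  obtain ⟨j, hj⟩ | hlast := (F K).eq_castSucc_or_eq_last
  · exact absurd ((hf j).superset (mem_cubesUnion.2 ⟨K, hj, hxK⟩)).2 (hp j)
  · exact mem_cubesUnion.2 ⟨K, hlast, hxK⟩

theorem ZeroSetsEncode.exists_fibre_subset (hf : ZeroSetsEncode F f) (hk : 0 < k)
    (p : Space d) : ∃ c, unitCube n ∩ f ⁻¹' {p} ⊆ cubesUnion (F ⁻¹' {c}) := by
  by_cases! hp : ∃ j, p j = 0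
  · obtain ⟨j, hj⟩ := hp
    exact ⟨_, hf.fibre_subset_of_apply_eq_zero hj⟩
  · exact ⟨_, hf.fibre_subset_of_forall_ne_zero hk hp⟩

theorem ZeroSetsEncode.exists_connectsFaces (hf : ZeroSetsEncode F f) (hk : 0 < k)
    {S : Set (Space n)} {i : Fin n} (hSp : S ⊆ unitCube n ∩ f ⁻¹' {p}) (hS : ConnectsFaces i S) :
    ∃ (c : Fin (d + 1)) (T : Set (cubes n k)),
      T ⊆ F ⁻¹' {c} ∧ S ⊆ cubesUnion T ∧ ConnectsFaces i (cubesUnion T) := by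
  obtain ⟨c, hc⟩ := hf.exists_fibre_subset hk p
  exact ⟨c, hS.exists_subset_cubesUnion (hSp.trans hc)⟩

theorem HasConnectingFibres.exists_connectsSomeFaces (h : HasConnectingFibres n d) (hk : 0 < k)
    (F : cubes n k → Fin (d + 1)) :
    ∃ (c : Fin (d + 1)) (T : Set (cubes n k)),
      T ⊆ F ⁻¹' {c} ∧ ConnectsSomeFaces (cubesUnion T) := by
  obtain ⟨f, hcont, hf⟩ := exists_continuous_zeroSetsEncode F
  obtain ⟨p, S, hSp, i, hS⟩ := h f hcont
  obtain ⟨c, T, hT, -, hconn⟩ := hf.exists_connectsFaces hk hSp hS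
  exact ⟨c, T, hT, i, hconn⟩

end Colorings

end LevelSetChess

open LevelSetChess in
theorem mainTheorem9_general (n d : ℕ) :
    (HasConnectingFibres n d → ∀ k : ℕ, 1 ≤ k → ∀ F : cubes n k → Fin (d + 1),
      ∃ (c : Fin (d + 1)) (T : Set (cubes n k)),
        T ⊆ F ⁻¹' {c} ∧ ConnectsSomeFaces (cubesUnion T)) ∧
    ∀ k : ℕ, 1 ≤ k → ∀ F : cubes n k → Fin (d + 1),
      (∃ f : Space n → Space d, Continuous f ∧ ZeroSetsEncode F f) ∧
      ∀ f : Space n → Space d, ZeroSetsEncode F f →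
        ∀ (p : Space d) (S : Set (Space n)) (i : Fin n),
          S ⊆ unitCube n ∩ f ⁻¹' {p} → ConnectsFaces i S →
          ∃ (c : Fin (d + 1)) (T : Set (cubes n k)),
            T ⊆ F ⁻¹' {c} ∧ S ⊆ cubesUnion T ∧ ConnectsFaces i (cubesUnion T) :=
  ⟨fun h _ hk F => h.exists_connectsSomeFaces hk F, fun _ hk F =>
    ⟨exists_continuous_zeroSetsEncode F, fun _ hf _ _ _ hSp hS =>
      hf.exists_connectsFaces hk hSp hS⟩⟩

theorem mainTheorem9 (n : ℕ) (hn : 1 ≤ n) :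
    (LevelSetChess.LevelSetTheorem n → LevelSetChess.SteinhausChessboardTheorem n) ∧
    ∀ k : ℕ, 1 ≤ k → ∀ F : LevelSetChess.cubes n k → Fin n,
      (∃ f : LevelSetChess.Space n → LevelSetChess.Space (n - 1),
        LevelSetChess.EncodesColoring F f) ∧
      ∀ f : LevelSetChess.Space n → LevelSetChess.Space (n - 1),
        LevelSetChess.EncodesColoring F f →
        ∀ (p : LevelSetChess.Space (n - 1)) (S : Set (LevelSetChess.Space n)) (i : Fin n),
          S ⊆ LevelSetChess.unitCube n ∩ f ⁻¹' {p} → LevelSetChess.ConnectsFaces i S →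
          ∃ (c : Fin n) (T : Set (LevelSetChess.cubes n k)),
            T ⊆ F ⁻¹' {c} ∧ S ⊆ LevelSetChess.cubesUnion T ∧
              LevelSetChess.ConnectsFaces i (LevelSetChess.cubesUnion T) := by
  obtain ⟨d, rfl⟩ := Nat.exists_eq_add_of_le' hn
  obtain ⟨hB, hF⟩ := mainTheorem9_general (d + 1) d
  exact ⟨fun h => hB h.hasConnectingFibres, fun k hk F =>
    ⟨(hF k hk F).1.imp fun _ hf => ⟨hf.1.continuousOn, hf.2⟩, fun f hf => (hF k hk F).2 f hf.2⟩⟩
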